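/- Consider the following average-cost Markov decision process. Let $R\ge 1$ and $\mathcal R=\{1,\dots,R\}$, let $P=(P_{r,r'})$ be a stochastic matrix on $\mathcal R$, and let $\lambda\in[0,1]$, $\omega(r)>0$ for all $r\in\mathcal R$, and $\eta>0$. The state is $(s,r)\in\{0,1,2,\dots\}\times\mathcal R$ ($s$ is the age of synchronization and $r$ the weight state of a node), the action is $u\in\{0,1\}$ ($u=1$: transmit, $u=0$: stay idle), and the cost of a slot is $C(s,r,u)=\omega(r)\,s+\eta u$. From state $(s,r)$ under action $u$ the next state is distributed as follows: - if $s>0$ and $u=1$, it is $(0,r')$ with probability $P_{r,r'}(1-\lambda)$ and $(1,r')$ with probability $P_{r,r'}\lambda$; - if $s>0$ and $u=0$, it is $(s+1,r')$ with probability $P_{r,r'}$; - if $s=0$, then for either action it is $(0,r')$ with probability $P_{r,r'}(1-\lambda)$ and $(1,r')$ with probability $P_{r,r'}\lambda$. A policy $\pi$ chooses, in each slot, the (possibly randomized) action as a function of the past states and actions and of the current state; it is stationary if this choice depends on the current state only. For an initial state $x$ put $$J_T(\pi,x)=\mathbb E_\pi^x\Big[\tfrac1T\sum_{t=1}^T C\big(s(t),R(t),u(t)\big)\Big],\qquad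 J(\pi,x)=\limsup_{T\to\infty}J_T(\pi,x).$$ Then there exist a stationary policy $\pi^*$ and thresholds $\tau_r\in\{0,1,2,\dots\}$, $r\in\mathcal R$, such that $\pi^*$ is optimal, that is, for every initial state $x$ the limit $\lim_{T\to\infty}J_T(\pi^*,x)$ exists and is finite and $J(\pi^*,x)\le J(\pi,x)$ for every policy $\pi$; and such that in every state $(s,r)$ the policy $\pi^*$ transmits with probability $1$ if $s\ge\tau_r$ and stays idle with probability $1$ if $s<\tau_r$. -/

import Mathlib

open Filter Topology
open scoped ENNReal NNReal

noncomputable section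

namespace AoS

/-- Parameters of a single node with `R` weight states. -/
structure Node (R : ℕ) where
  /-- probability that a new update arrives in a slot -/
  lam : ℝ
  lam_nonneg : 0 ≤ lam
  lam_le_one : lam ≤ 1
  /-- `P r r'` is the transition probability of the weight state from `r` to `r'` -/
  P : Fin R → PMF (Fin R)
  /-- weight attached to each weight state -/
  ω : Fin R → ℝ
  ω_pos : ∀ r, 0 < ω r
  /-- price of one transmission (the Lagrange multiplier) -/
  η : ℝ
  η_pos : 0 < η

/-- A state is a pair `(s, r)`: age of synchronization and weight state. -/
abbrev State (R : ℕ) : Type := ℕ × Fin R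

/-- `true` means transmit (`u = 1`), `false` means stay idle (`u = 0`). -/
abbrev Action : Type := Bool

/-- The past: the list of state-action pairs of the elapsed slots, most recent first. -/
abbrev History (R : ℕ) : Type := List (State R × Action)

/-- A randomized history-dependent policy: given the past and the current state, the law of the
current action. -/
abbrev Policy (R : ℕ) : Type := History R → State R → PMF Action

/-- A randomized stationary policy: the law of the action depends on the current state only. -/
abbrev StationaryPolicy (R : ℕ) : Type := State R → PMF Action

/-- A stationary policy, regarded as a policy. -/
def StationaryPolicy.toPolicy {R : ℕ} (f : StationaryPolicy R) : Policy R := fun _ x => f x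

variable {R : ℕ}

namespace Node

/-- Law of the indicator that a new update arrives in the current slot. -/
def arrivalLaw (N : Node R) : PMF Bool :=
  PMF.ofFintype (fun a => if a then ENNReal.ofReal N.lam else ENNReal.ofReal (1 - N.lam)) (by
    have h := N.lam_le_one
    simp only [Fintype.sum_bool, if_true, Bool.false_eq_true, if_false]
    rw [← ENNReal.ofReal_add N.lam_nonneg (by linarith)]
    simp)

end Node

/-- Age in the next slot, given the age `s`, the action `u` and the arrival indicator `a`: a node
that is synchronized or transmits has age `1` or `0` afterwards, according to whether a new update
has arrived; otherwise the age grows by one. -/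
def nextAge (s : ℕ) (u : Action) (a : Bool) : ℕ :=
  if s = 0 ∨ u = true then (if a then 1 else 0) else s + 1

namespace Node

/-- Transition law of the decision process: the arrival and the weight transition are
independent. -/
def step (N : Node R) (x : State R) (u : Action) : PMF (State R) :=
  N.arrivalLaw.bind fun a => (N.P x.2).map fun r' => (nextAge x.1 u a, r')

/-- Cost `ω(r) s + η u` of one slot. -/
def cost (N : Node R) (x : State R) (u : Action) : ℝ :=
  N.ω x.2 * (x.1 : ℝ) + N.η * (if u then 1 else 0)

/-- Joint law, under the policy `π` and from the initial state `x`, of the first `T` state-action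
pairs and of the state that follows them. -/
def law (N : Node R) (π : Policy R) (x : State R) : ℕ → PMF (History R × State R)
  | 0 => PMF.pure ([], x)
  | T + 1 => (N.law π x T).bind fun p =>
      (π p.1 p.2).bind fun u =>
        (N.step p.2 u).map fun y => ((p.2, u) :: p.1, y)

/-- Expected average cost of the first `T` slots. Costs are nonnegative, so the expectation is taken
in `[0, ∞]`. -/
def expectedAverage (N : Node R) (π : Policy R) (x : State R) (T : ℕ) : ℝ≥0∞ :=
  ∑' p : History R × State R, N.law π x T p *
    ENNReal.ofReal ((1 / (T : ℝ)) * (p.1.map fun z => N.cost z.1 z.2).sum)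

/-- Long-run expected average cost. -/
def averageCost (N : Node R) (π : Policy R) (x : State R) : ℝ≥0∞ :=
  limsup (fun T : ℕ => N.expectedAverage π x T) atTop

/-- `π` is average-cost optimal: from every initial state its expected average cost converges to a
finite limit, and no policy has a smaller long-run average cost. -/
def IsOptimal (N : Node R) (π : Policy R) : Prop :=
  ∀ x : State R,
    (∃ J : ℝ≥0, Tendsto (fun T : ℕ => N.expectedAverage π x T) atTop (𝓝 (J : ℝ≥0∞))) ∧
    ∀ π' : Policy R, N.averageCost π x ≤ N.averageCost π' x

end Node

end AoS

end

/-! The argument is a vanishing-discount argument that needs no relative value function. For a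
discount factor `a`, value iteration from `0` gives a fixed point of the optimality operator which
is a lower bound for every policy (`value_le_tsum`) and is attained by greedy stationary policies
(`tsum_le_of_expect_qValue_le`). The value increases with the age, whereas the continuation after
transmitting does not depend on the age, so the greedy action has threshold form. For `a ≥ 1/2` the
thresholds are bounded by some `B` independent of `a` (`transmit_le_idle`), so only finitely many
threshold vectors occur, and one of them is optimal for discount factors arbitrarily close to one.

Under a threshold policy the process started at a given state stays in a finite set, so its averages
converge (`exists_tendsto_average_stageCost`). An Abelian comparison then turns discounted
optimality along the sequence into average optimality
(`le_limsup_average_of_frequently_discounted_le`). Working in `[0, ∞]` removes all summability and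
finiteness conditions. -/

noncomputable section

namespace AoS

/-! ### Expectations of `[0, ∞]`-valued functions under a `PMF` -/

section Expect

variable {α β : Type*}

/-- Expectation of a `[0, ∞]`-valued function under a probability mass function. -/
def expect (p : PMF α) (g : α → ℝ≥0∞) : ℝ≥0∞ := ∑' a, p a * g a

theorem expect_mono (p : PMF α) {g h : α → ℝ≥0∞} (hgh : ∀ a, g a ≤ h a) :
    expect p g ≤ expect p h :=
  ENNReal.tsum_le_tsum fun a => mul_le_mul_right (hgh a) _

theorem expect_const (p : PMF α) (c : ℝ≥0∞) : expect p (fun _ => c) = c := by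
  simp [expect, ENNReal.tsum_mul_right, p.tsum_coe]

theorem expect_add (p : PMF α) (g h : α → ℝ≥0∞) :
    expect p (fun a => g a + h a) = expect p g + expect p h := by
  simp [expect, mul_add, ENNReal.tsum_add]

theorem expect_const_mul (p : PMF α) (c : ℝ≥0∞) (g : α → ℝ≥0∞) :
    expect p (fun a => c * g a) = c * expect p g := by
  simp only [expect, mul_left_comm _ c, ENNReal.tsum_mul_left]

theorem expect_pure (a : α) (g : α → ℝ≥0∞) : expect (PMF.pure a) g = g a := by
  rw [expect, tsum_eq_single a]
  · simp
  · intro b hb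
    simp [PMF.pure_apply, hb]

theorem expect_bind (p : PMF α) (k : α → PMF β) (g : β → ℝ≥0∞) :
    expect (p.bind k) g = expect p fun a => expect (k a) g := by
  simp only [expect, PMF.bind_apply, ← ENNReal.tsum_mul_right, ← ENNReal.tsum_mul_left]
  rw [ENNReal.tsum_comm]
  simp only [mul_assoc]

theorem expect_map (p : PMF α) (φ : α → β) (g : β → ℝ≥0∞) :
    expect (p.map φ) g = expect p fun a => g (φ a) := by
  rw [← PMF.bind_pure_comp, expect_bind]
  simp [expect_pure]

/-- Monotone convergence. -/
theorem expect_iSup (p : PMF α) {g : ℕ → α → ℝ≥0∞} (hg : Monotone g) :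
    expect p (fun a => ⨆ n, g n a) = ⨆ n, expect p (g n) := by
  simp only [expect, ENNReal.mul_iSup]
  simp only [ENNReal.tsum_eq_iSup_sum]
  rw [iSup_comm]
  refine iSup_congr fun s => ?_
  exact ENNReal.finsetSum_iSup_of_monotone
    fun a n m hnm => mul_le_mul_right (hg hnm a) (p a)

end Expect

/-! ### Abel sums -/

/-- Summation by parts for Abel sums of `[0, ∞]`-valued sequences. -/
theorem tsum_pow_mul_eq (a : ℝ≥0∞) (ha : a < 1) (e : ℕ → ℝ≥0∞) :
    ∑' t, a ^ t * e t = (1 - a) * ∑' T, a ^ T * ∑ t ∈ Finset.range (T + 1), e t := by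
  -- Each power is a normalized geometric tail; exchanging the two sums then produces the partial
  -- sums of `e`.
  have h1 : ∀ t, a ^ t = (1 - a) * ∑' T, if t ≤ T then a ^ T else 0 := by
    intro t
    have : ∑' T, (if t ≤ T then a ^ T else 0) = ∑' j, a ^ (j + t) := by
      rw [← ENNReal.summable.sum_add_tsum_nat_add' (f := fun T => if t ≤ T then a ^ T else 0)
        (k := t), Finset.sum_eq_zero]
      · simp
      · intro i hi
        simp [Finset.mem_range.1 hi]
    rw [this]
    simp only [pow_add, ENNReal.tsum_mul_right, ENNReal.tsum_geometric]
    rw [← mul_assoc, ENNReal.mul_inv_cancel, one_mul]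
    · exact (tsub_pos_of_lt ha).ne'
    · exact (tsub_le_self.trans_lt ENNReal.one_lt_top).ne
  have h2 : ∀ T, ∑ t ∈ Finset.range (T + 1), e t = ∑' t, if t ≤ T then e t else 0 := by
    intro T
    rw [tsum_eq_sum (s := Finset.range (T + 1))]
    · refine Finset.sum_congr rfl fun t ht => ?_
      simp [Nat.lt_succ_iff.1 (Finset.mem_range.1 ht)]
    · intro t ht
      simp only [Finset.mem_range, not_lt] at ht
      simp [show ¬ t ≤ T by omega]
  calc ∑' t, a ^ t * e t
      = ∑' t, (1 - a) * ∑' T, a ^ T * (if t ≤ T then e t else 0) := by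
        refine tsum_congr fun t => ?_
        rw [h1 t, mul_assoc, ← ENNReal.tsum_mul_right]
        congr 2
        ext T
        split_ifs <;> simp
    _ = _ := by
        rw [ENNReal.tsum_mul_left, ENNReal.tsum_comm]
        simp only [ENNReal.tsum_mul_left, h2]

/-- An Abel sum is a nonnegative combination of partial sums, so no termwise comparison is needed.
-/
theorem tsum_pow_mul_le {a : ℝ≥0∞} (ha : a < 1) {e d : ℕ → ℝ≥0∞}
    (h : ∀ T, ∑ t ∈ Finset.range T, e t ≤ ∑ t ∈ Finset.range T, d t) :
    ∑' t, a ^ t * e t ≤ ∑' t, a ^ t * d t := by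
  rw [tsum_pow_mul_eq a ha e, tsum_pow_mul_eq a ha d]
  exact mul_le_mul_right (ENNReal.tsum_le_tsum fun T => mul_le_mul_right (h _) _) _

/-- Discount factors increasing to one. -/
def discount (n : ℕ) : ℝ≥0∞ := 1 - ((n : ℝ≥0∞) + 2)⁻¹

theorem discount_lt_one (n : ℕ) : discount n < 1 := by
  refine ENNReal.sub_lt_self ENNReal.one_ne_top one_ne_zero ?_
  simp

theorem one_sub_discount (n : ℕ) : 1 - discount n = ((n : ℝ≥0∞) + 2)⁻¹ := by
  refine ENNReal.sub_sub_cancel ENNReal.one_ne_top ?_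
  rw [ENNReal.inv_le_one]
  exact le_add_left one_le_two

theorem half_le_discount (n : ℕ) : 2⁻¹ ≤ discount n := by
  rw [discount, ← ENNReal.one_sub_inv_two]
  refine tsub_le_tsub_left (ENNReal.inv_le_inv.2 ?_) _
  exact le_add_left le_rfl

theorem tsum_discount_pow (n : ℕ) (C : ℝ≥0∞) :
    ∑' t, discount n ^ t * C = (n + 2) * C := by
  rw [ENNReal.tsum_mul_right, ENNReal.tsum_geometric, one_sub_discount, inv_inv]

/-- If along a sequence of discount factors tending to one the discounted sums of `e` are at most
those of `d`, then a limit of the averages of `e` is at most the upper limit of the averages of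
`d`. -/
theorem le_limsup_average_of_frequently_discounted_le {e d : ℕ → ℝ≥0∞} {J : ℝ≥0∞}
    (hJ : Tendsto (fun T : ℕ => (T : ℝ≥0∞)⁻¹ * ∑ t ∈ Finset.range T, e t) atTop (𝓝 J))
    (h : ∃ᶠ n in atTop, ∑' t, discount n ^ t * e t ≤ ∑' t, discount n ^ t * d t) :
    J ≤ limsup (fun T : ℕ => (T : ℝ≥0∞)⁻¹ * ∑ t ∈ Finset.range T, d t) atTop := by
  by_contra! hlt
  obtain ⟨C, hC, hC'⟩ := ENNReal.lt_iff_exists_nnreal_btwn.1 hlt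
  obtain ⟨D, hCD, hD⟩ := ENNReal.lt_iff_exists_nnreal_btwn.1 hC'
  -- A lump `K` added in slot `0` raises every nonempty partial sum by `K`. It turns bounds valid
  -- for large `T` into bounds valid for all `T`.
  have key : ∀ (e : ℕ → ℝ≥0∞) (K : ℝ≥0∞) (T : ℕ), 0 < T →
      ∑ t ∈ Finset.range T, (e t + if t = 0 then K else 0) = ∑ t ∈ Finset.range T, e t + K := by
    intro e K T hT
    rw [Finset.sum_add_distrib]
    simp [hT]
  have keyTsum : ∀ (a : ℝ≥0∞) (e : ℕ → ℝ≥0∞) (K : ℝ≥0∞),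
      ∑' t, a ^ t * (e t + if t = 0 then K else 0) = ∑' t, a ^ t * e t + K := by
    intro a e K
    simp only [mul_add, ENNReal.tsum_add, mul_ite, mul_zero]
    rw [tsum_eq_single (f := fun t => if t = 0 then a ^ t * K else 0) 0]
    · simp
    · intro b hb; simp [hb]
  -- the averages of `d` are eventually below `C`
  obtain ⟨K, hK⟩ : ∃ K : ℝ≥0, ∀ T, ∑ t ∈ Finset.range T, d t ≤
      ∑ t ∈ Finset.range T, ((C : ℝ≥0∞) + if t = 0 then (K : ℝ≥0∞) else 0) := by
    obtain ⟨T₀, hT₀⟩ := eventually_atTop.1 (eventually_lt_of_limsup_lt hC)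
    have hle : ∀ T, T₀ ≤ T → 0 < T → ∑ t ∈ Finset.range T, d t ≤ T * C := by
      intro T hT hpos
      have := (hT₀ T hT).le
      rw [ENNReal.inv_mul_le_iff (by positivity) (by simp)] at this
      exact this
    -- For `T ≤ T₀` the partial sum is at most the one at `T₀ + 1`, a length that is positive even
    -- if `T₀ = 0`.
    refine ⟨(T₀ + 1 : ℕ) * C, fun T => ?_⟩
    rcases Nat.eq_zero_or_pos T with rfl | hpos
    · simp
    rw [key _ _ _ hpos]
    rcases le_total T₀ T with hT | hT
    · exact (hle T hT hpos).trans (by simp)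
    · calc ∑ t ∈ Finset.range T, d t ≤ ∑ t ∈ Finset.range (T₀ + 1), d t :=
            Finset.sum_le_sum_of_subset (Finset.range_mono (by omega))
        _ ≤ (T₀ + 1 : ℕ) * C := hle _ (by omega) (by omega)
        _ ≤ _ := by push_cast; exact le_add_self
  -- the averages of `e` are eventually above `D`
  obtain ⟨L, hL⟩ : ∃ L : ℝ≥0, ∀ T, ∑ t ∈ Finset.range T, (D : ℝ≥0∞) ≤
      ∑ t ∈ Finset.range T, (e t + if t = 0 then (L : ℝ≥0∞) else 0) := by
    obtain ⟨T₀, hT₀⟩ := eventually_atTop.1 (hJ.eventually_const_lt hD)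
    refine ⟨T₀ * D, fun T => ?_⟩
    rcases Nat.eq_zero_or_pos T with rfl | hpos
    · simp
    rw [key _ _ _ hpos]
    simp only [Finset.sum_const, Finset.card_range, nsmul_eq_mul]
    rcases le_total T₀ T with hT | hT
    · have := (hT₀ T hT).le
      rw [mul_comm, ← div_eq_mul_inv, ENNReal.le_div_iff_mul_le (by simp; omega) (by simp)] at this
      rw [mul_comm]
      exact this.trans le_self_add
    · refine le_trans ?_ le_add_self
      push_cast
      gcongr
  -- A constant `C` has discounted sum `(n + 2) * C`. The lumps contribute only the bounded amount
  -- `K + L`, which cannot cover `(n + 2) * (D - C)` for large `n`.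
  have hbound : ∃ᶠ n : ℕ in atTop, ((n + 2) * D : ℝ≥0) ≤ (n + 2) * C + K + L := by
    refine h.mono fun n hn => ?_
    have h1 := tsum_pow_mul_le (discount_lt_one n) hK
    have h2 := tsum_pow_mul_le (discount_lt_one n) hL
    rw [keyTsum, tsum_discount_pow] at h1
    rw [keyTsum, tsum_discount_pow] at h2
    have h3 : ((n : ℝ≥0∞) + 2) * D ≤ (n + 2) * C + K + L :=
      h2.trans (add_le_add_left (hn.trans h1) _)
    exact_mod_cast h3
  have hCD' : (C : ℝ) < D := by exact_mod_cast hCD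
  obtain ⟨m, hm⟩ := exists_nat_gt (((K : ℝ) + L) / (D - C))
  obtain ⟨n, hmn, hn⟩ := frequently_atTop.1 hbound m
  have hn' : ((n : ℝ) + 2) * D ≤ (n + 2) * C + K + L := by exact_mod_cast hn
  rw [div_lt_iff₀ (by linarith)] at hm
  have hmn' : (m : ℝ) ≤ n := by exact_mod_cast hmn
  nlinarith

/-! ### Averages of powers of a finite-dimensional contraction -/

/-- Mean ergodic theorem for a linear contraction of a finite-dimensional space. -/
theorem exists_tendsto_average_of_contraction {E : Type*} [NormedAddCommGroup E]
    [NormedSpace ℝ E] [FiniteDimensional ℝ E] (A : E →ₗ[ℝ] E) (hA : ∀ v, ‖A v‖ ≤ ‖v‖) (v : E) :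
    ∃ a, Tendsto (fun n : ℕ => (n : ℝ)⁻¹ • ∑ t ∈ Finset.range n, (A ^ t) v) atTop (𝓝 a) := by
  have hpow : ∀ (t : ℕ) v, ‖(A ^ t) v‖ ≤ ‖v‖ := by
    intro t
    induction t with
    | zero => simp
    | succ t ih => intro v; rw [pow_succ, Module.End.mul_apply]; exact (ih _).trans (hA v)
  have htel : ∀ b (n : ℕ), ∑ t ∈ Finset.range n, (A ^ t) (A b - b) = (A ^ n) b - b := by
    intro b n
    induction n with
    | zero => simp
    | succ n ih =>
      rw [Finset.sum_range_succ, ih, map_sub, ← Module.End.mul_apply, ← pow_succ]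
      abel
  have hfix : ∀ a, A a = a → ∀ t : ℕ, (A ^ t) a = a := by
    intro a ha t
    induction t with
    | zero => simp
    | succ t ih => rw [pow_succ, Module.End.mul_apply, ha, ih]
  have hzero : ∀ b, Tendsto (fun n : ℕ => (n : ℝ)⁻¹ • ((A ^ n) b - b)) atTop (𝓝 0) := by
    intro b
    refine squeeze_zero_norm (a := fun n : ℕ => (n : ℝ)⁻¹ * (2 * ‖b‖)) (fun n => ?_) ?_
    · rw [norm_smul, norm_inv, Real.norm_natCast]
      gcongr
      linarith [norm_sub_le ((A ^ n) b) b, hpow n b]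
    · simpa using (tendsto_inv_atTop_nhds_zero_nat (𝕜 := ℝ)).mul_const (2 * ‖b‖)
  -- A fixed vector `A b - b` equals its own averages, which telescope and tend to `0`. Rank-nullity
  -- then splits the space into fixed vectors and the range of `A - 1`.
  have hdisj : Disjoint (LinearMap.ker (A - 1)) (LinearMap.range (A - 1)) := by
    rw [Submodule.disjoint_def]
    rintro _ hz ⟨b, rfl⟩
    have hz' : A (A b - b) = A b - b := by
      simpa [sub_eq_zero] using hz
    have hconst : ∀ᶠ n : ℕ in atTop, (n : ℝ)⁻¹ • ((A ^ n) b - b) = A b - b := by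
      filter_upwards [eventually_gt_atTop 0] with n hn
      rw [← htel b n, Finset.sum_congr rfl fun t _ => hfix _ hz' t]
      rw [Finset.sum_const, Finset.card_range, ← Nat.cast_smul_eq_nsmul ℝ, smul_smul,
        inv_mul_cancel₀ (by positivity), one_smul]
    have := tendsto_nhds_unique ((hzero b).congr' hconst) tendsto_const_nhds
    simpa using this.symm
  have hsup : LinearMap.ker (A - 1) ⊔ LinearMap.range (A - 1) = ⊤ := by
    refine Submodule.eq_top_of_disjoint _ _ ?_ hdisj
    rw [add_comm]
    exact (LinearMap.finrank_range_add_finrank_ker _).ge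
  obtain ⟨a, ha, _, ⟨b, rfl⟩, rfl⟩ := Submodule.mem_sup.1 (hsup.symm ▸ Submodule.mem_top (x := v))
  have ha' : A a = a := by simpa [sub_eq_zero] using ha
  refine ⟨a, ?_⟩
  have hlim := (tendsto_const_nhds (x := a)).add (hzero b)
  rw [add_zero] at hlim
  refine hlim.congr' ?_
  filter_upwards [eventually_gt_atTop 0] with n hn
  simp only [map_add, Finset.sum_add_distrib, smul_add, LinearMap.sub_apply, Module.End.one_apply]
  rw [htel, Finset.sum_congr rfl fun t _ => hfix a ha' t, Finset.sum_const, Finset.card_range,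
    ← Nat.cast_smul_eq_nsmul ℝ, smul_smul, inv_mul_cancel₀ (by positivity), one_smul]

/-- The averages of the expected costs of a Markov chain with finitely many states converge. -/
theorem exists_tendsto_average_expect_iterate {S : Type*} [Fintype S] (k : S → PMF S)
    (c : S → ℝ≥0) (x : S) :
    ∃ J : ℝ≥0, Tendsto (fun n : ℕ => (n : ℝ≥0∞)⁻¹ *
      ∑ t ∈ Finset.range n, (fun g y => expect (k y) g)^[t] (fun y => (c y : ℝ≥0∞)) x)
      atTop (𝓝 (J : ℝ≥0∞)) := by
  classical
  let A : (S → ℝ) →ₗ[ℝ] (S → ℝ) := Matrix.toLin' (Matrix.of fun y z => (k y z).toReal)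
  have hAapply : ∀ g y, A g y = ∑ z, (k y z).toReal * g z := fun g y => rfl
  have hsum : ∀ y, ∑ z, (k y z).toReal = 1 := by
    intro y
    rw [← ENNReal.toReal_sum fun z _ => (k y).apply_ne_top z, ← tsum_fintype (L := .unconditional S),
      (k y).tsum_coe]
    rfl
  -- A row-stochastic matrix is a contraction for the sup norm.
  have hA : ∀ g, ‖A g‖ ≤ ‖g‖ := by
    intro g
    refine (pi_norm_le_iff_of_nonneg (norm_nonneg _)).2 fun y => ?_
    rw [hAapply]
    calc ‖∑ z, (k y z).toReal * g z‖ ≤ ∑ z, (k y z).toReal * ‖g‖ := by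
          refine norm_sum_le_of_le _ fun z _ => ?_
          rw [norm_mul, Real.norm_of_nonneg ENNReal.toReal_nonneg]
          gcongr
          exact norm_le_pi_norm g z
      _ = ‖g‖ := by rw [← Finset.sum_mul, hsum, one_mul]
  have hiter : ∀ t : ℕ, ∀ y, 0 ≤ (A ^ t) (fun y => (c y : ℝ)) y ∧
      (fun g y => expect (k y) g)^[t] (fun y => (c y : ℝ≥0∞)) y =
        ENNReal.ofReal ((A ^ t) (fun y => (c y : ℝ)) y) := by
    intro t
    induction t with
    | zero => intro y; simp
    | succ t ih =>
      intro y
      rw [pow_succ', Module.End.mul_apply, hAapply, Function.iterate_succ_apply']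
      refine ⟨Finset.sum_nonneg fun z _ => mul_nonneg ENNReal.toReal_nonneg (ih z).1, ?_⟩
      rw [ENNReal.ofReal_sum_of_nonneg
        fun z _ => mul_nonneg ENNReal.toReal_nonneg (ih z).1, expect, tsum_fintype]
      refine Finset.sum_congr rfl fun z _ => ?_
      rw [ENNReal.ofReal_mul ENNReal.toReal_nonneg, ENNReal.ofReal_toReal ((k y).apply_ne_top z),
        (ih z).2]
  obtain ⟨a, ha⟩ := exists_tendsto_average_of_contraction A hA (fun y => (c y : ℝ))
  refine ⟨(a x).toNNReal, ?_⟩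
  have hx := ENNReal.tendsto_ofReal ((tendsto_pi_nhds.1 ha) x)
  refine hx.congr' ?_
  filter_upwards [eventually_gt_atTop 0] with n hn
  rw [Finset.sum_congr rfl fun t _ => (hiter t x).2,
    ← ENNReal.ofReal_sum_of_nonneg fun t _ => (hiter t x).1, Pi.smul_apply, smul_eq_mul,
    ENNReal.ofReal_mul (by positivity), ENNReal.ofReal_inv_of_pos (by positivity),
    ENNReal.ofReal_natCast, Finset.sum_apply]

variable {R : ℕ}

/-! ### Transition law and cost -/

theorem nextAge_mono (u : Action) (b : Bool) : Monotone fun s => nextAge s u b := by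
  intro s s' h
  simp only [nextAge]
  split_ifs <;> first | omega | simp_all

namespace Node

theorem expect_step (N : Node R) (x : State R) (u : Action) (g : State R → ℝ≥0∞) :
    expect (N.step x u) g =
      expect N.arrivalLaw fun b => expect (N.P x.2) fun r' => g (nextAge x.1 u b, r') := by
  simp only [step, expect_bind, expect_map]

theorem ofReal_cost (N : Node R) (x : State R) (u : Action) :
    ENNReal.ofReal (N.cost x u) =
      ENNReal.ofReal (N.ω x.2) * x.1 + if u then ENNReal.ofReal N.η else 0 := by
  have hω := (N.ω_pos x.2).le
  have hη := N.η_pos.le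
  rw [cost, ENNReal.ofReal_add (by positivity) (by positivity), ENNReal.ofReal_mul hω,
    ENNReal.ofReal_natCast]
  cases u <;> simp

theorem cost_nonneg (N : Node R) (x : State R) (u : Action) : 0 ≤ N.cost x u := by
  have hω := (N.ω_pos x.2).le
  have hη := N.η_pos.le
  rw [cost]
  positivity

/-! ### Expected costs of the individual slots -/

/-- Expected cost of slot `t`, the slots being numbered from `0`. -/
def stageCost (N : Node R) (π : Policy R) (x : State R) (t : ℕ) : ℝ≥0∞ :=
  expect (N.law π x t) fun p => expect (π p.1 p.2) fun u => ENNReal.ofReal (N.cost p.2 u)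

theorem expect_law_succ (N : Node R) (π : Policy R) (x : State R) (t : ℕ)
    (g : History R × State R → ℝ≥0∞) :
    expect (N.law π x (t + 1)) g = expect (N.law π x t) fun p => expect (π p.1 p.2) fun u =>
      expect (N.step p.2 u) fun y => g ((p.2, u) :: p.1, y) := by
  simp only [law, expect_bind, expect_map]

/-- Linearity of expectation: costs already in the history are unaffected by averaging over the next
action and state. -/
theorem expectedAverage_eq (N : Node R) (π : Policy R) (x : State R) {T : ℕ} (hT : 0 < T) :
    N.expectedAverage π x T = (T : ℝ≥0∞)⁻¹ * ∑ t ∈ Finset.range T, N.stageCost π x t := by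
  have hsum : ∀ T, expect (N.law π x T) (fun p =>
      ENNReal.ofReal (p.1.map fun z => N.cost z.1 z.2).sum) =
        ∑ t ∈ Finset.range T, N.stageCost π x t := by
    intro T
    induction T with
    | zero => simp [law, expect_pure]
    | succ T ih =>
      rw [Finset.sum_range_succ, ← ih, stageCost, ← expect_add, expect_law_succ]
      congr 1
      ext p
      have hp : 0 ≤ (p.1.map fun z => N.cost z.1 z.2).sum :=
        List.sum_nonneg (by simp only [List.mem_map]; rintro _ ⟨z, _, rfl⟩; exact N.cost_nonneg _ _)
      simp only [List.map_cons, List.sum_cons, expect_const]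
      simp only [ENNReal.ofReal_add (N.cost_nonneg _ _) hp, expect_add, expect_const]
      rw [add_comm]
  rw [← hsum, ← expect_const_mul]
  refine tsum_congr fun p => ?_
  rw [ENNReal.ofReal_mul (by positivity), one_div, ENNReal.ofReal_inv_of_pos (by positivity),
    ENNReal.ofReal_natCast]

/-! ### The discounted problem -/

/-- Cost of using action `u` in state `x` and paying `V` afterwards, with discount factor `a`. -/
def qValue (N : Node R) (a : ℝ≥0∞) (V : State R → ℝ≥0∞) (x : State R) (u : Action) : ℝ≥0∞ :=
  ENNReal.ofReal (N.cost x u) + a * expect (N.step x u) V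

/-- The optimality operator of the discounted problem. -/
def bellman (N : Node R) (a : ℝ≥0∞) (V : State R → ℝ≥0∞) (x : State R) : ℝ≥0∞ :=
  min (N.qValue a V x true) (N.qValue a V x false)

/-- The optimal discounted cost, as the limit of the optimal costs over finite horizons. -/
def value (N : Node R) (a : ℝ≥0∞) (x : State R) : ℝ≥0∞ := ⨆ n : ℕ, (N.bellman a)^[n] 0 x

theorem bellman_le_qValue (N : Node R) (a : ℝ≥0∞) (V : State R → ℝ≥0∞) (x : State R)
    (u : Action) : N.bellman a V x ≤ N.qValue a V x u := by
  cases u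
  · exact min_le_right _ _
  · exact min_le_left _ _

theorem qValue_mono (N : Node R) (a : ℝ≥0∞) {V W : State R → ℝ≥0∞} (h : V ≤ W) (x : State R)
    (u : Action) : N.qValue a V x u ≤ N.qValue a W x u :=
  add_le_add_right (mul_le_mul_right (expect_mono _ h) _) _

theorem bellman_mono (N : Node R) (a : ℝ≥0∞) : Monotone (N.bellman a) := fun _ _ h x =>
  min_le_min (N.qValue_mono a h x true) (N.qValue_mono a h x false)

theorem monotone_iterate_bellman (N : Node R) (a : ℝ≥0∞) :
    Monotone fun n : ℕ => (N.bellman a)^[n] 0 :=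
  (N.bellman_mono a).monotone_iterate_of_le_map fun _ => zero_le

theorem qValue_value (N : Node R) (a : ℝ≥0∞) (x : State R) (u : Action) :
    N.qValue a (N.value a) x u = ⨆ n : ℕ, N.qValue a ((N.bellman a)^[n] 0) x u := by
  simp only [qValue]
  rw [← ENNReal.add_iSup, ← ENNReal.mul_iSup, ← expect_iSup _ (N.monotone_iterate_bellman a)]
  rfl

/-- The minimum of two increasing sequences commutes with their suprema, so monotone convergence
passes to the limit in value iteration. -/
theorem bellman_value (N : Node R) (a : ℝ≥0∞) : N.bellman a (N.value a) = N.value a := by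
  ext x
  have hmono : ∀ u, Monotone fun n : ℕ => N.qValue a ((N.bellman a)^[n] 0) x u := fun u _ _ h =>
    N.qValue_mono a (N.monotone_iterate_bellman a h) x u
  rw [bellman, qValue_value, qValue_value, ← iSup_inf_of_monotone (hmono true) (hmono false)]
  have hsucc : ∀ n : ℕ, N.qValue a ((N.bellman a)^[n] 0) x true ⊓
      N.qValue a ((N.bellman a)^[n] 0) x false = (N.bellman a)^[n + 1] 0 x := fun n => by
    rw [Function.iterate_succ_apply']; rfl
  simp only [hsucc, value]
  exact Monotone.iSup_nat_add (f := fun n : ℕ => (N.bellman a)^[n] 0 x)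
    (fun _ _ h => N.monotone_iterate_bellman a h x) 1

/-- No policy has a discounted cost below `value`. -/
theorem value_le_tsum (N : Node R) (a : ℝ≥0∞) (π : Policy R) (x : State R) :
    N.value a x ≤ ∑' t, a ^ t * N.stageCost π x t := by
  -- The starting slot `k` stays general because the induction on the horizon `n` removes the first
  -- slot.
  have h : ∀ n k : ℕ, expect (N.law π x k) (fun p => (N.bellman a)^[n] 0 p.2) ≤
      ∑ t ∈ Finset.range n, a ^ t * N.stageCost π x (k + t) := by
    intro n
    induction n with
    | zero => intro k; simp [expect]
    | succ n ih =>
      intro k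
      rw [Finset.sum_range_succ', add_comm (Finset.sum _ _)]
      calc expect (N.law π x k) (fun p => (N.bellman a)^[n + 1] 0 p.2)
          ≤ expect (N.law π x k) (fun p => expect (π p.1 p.2)
              (N.qValue a ((N.bellman a)^[n] 0) p.2)) := by
            refine expect_mono _ fun p => ?_
            rw [Function.iterate_succ_apply', ← expect_const (π p.1 p.2) (N.bellman a _ _)]
            exact expect_mono _ fun u => N.bellman_le_qValue a _ _ u
        _ = N.stageCost π x k +
              a * expect (N.law π x (k + 1)) (fun p => (N.bellman a)^[n] 0 p.2) := by
            unfold qValue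
            simp only [expect_add, expect_const_mul, expect_law_succ]
            rfl
        _ ≤ _ := by
            refine add_le_add (by simp) ?_
            refine (mul_le_mul_right (ih (k + 1)) a).trans_eq ?_
            rw [Finset.mul_sum]
            refine Finset.sum_congr rfl fun t _ => ?_
            rw [pow_succ', mul_assoc, add_right_comm, add_assoc]
  refine iSup_le fun n => ?_
  have h0 := h n 0
  simp only [law, expect_pure, zero_add] at h0
  exact h0.trans (ENNReal.sum_le_tsum _)

/-- A stationary policy that is greedy for `V` has discounted cost at most `V`. -/
theorem tsum_le_of_expect_qValue_le (N : Node R) (a : ℝ≥0∞) (f : StationaryPolicy R)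
    (V : State R → ℝ≥0∞) (hV : ∀ x, expect (f x) (N.qValue a V x) ≤ V x) (x : State R) :
    ∑' t, a ^ t * N.stageCost f.toPolicy x t ≤ V x := by
  have h : ∀ n k : ℕ, ∑ t ∈ Finset.range n, a ^ t * N.stageCost f.toPolicy x (k + t) ≤
      expect (N.law f.toPolicy x k) (fun p => V p.2) := by
    intro n
    induction n with
    | zero => intro k; simp
    | succ n ih =>
      intro k
      rw [Finset.sum_range_succ', add_comm]
      calc _ ≤ N.stageCost f.toPolicy x k +
              a * expect (N.law f.toPolicy x (k + 1)) (fun p => V p.2) := by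
            refine add_le_add (by simp) ?_
            refine le_of_eq_of_le ?_ (mul_le_mul_right (ih (k + 1)) a)
            rw [Finset.mul_sum]
            refine Finset.sum_congr rfl fun t _ => ?_
            rw [pow_succ', mul_assoc, add_right_comm, add_assoc]
        _ = expect (N.law f.toPolicy x k) (fun p => expect (f p.2) (N.qValue a V p.2)) := by
            unfold qValue
            simp only [expect_add, expect_const_mul, expect_law_succ]
            rfl
        _ ≤ _ := expect_mono _ fun p => hV p.2
  refine ENNReal.summable.tsum_le_of_sum_range_le fun n => ?_
  have h0 := h n 0
  simpa only [law, expect_pure, zero_add] using h0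

/-! ### Threshold structure of the discounted problem -/

theorem expect_step_mono_age (N : Node R) {V : State R → ℝ≥0∞}
    (hV : ∀ r, Monotone fun s => V (s, r)) (r : Fin R) (u : Action) :
    Monotone fun s => expect (N.step (s, r) u) V := by
  intro s s' h
  simp only [expect_step]
  exact expect_mono _ fun b => expect_mono _ fun r' => hV r' (nextAge_mono u b h)

theorem qValue_mono_age (N : Node R) (a : ℝ≥0∞) {V : State R → ℝ≥0∞}
    (hV : ∀ r, Monotone fun s => V (s, r)) (r : Fin R) (u : Action) :
    Monotone fun s => N.qValue a V (s, r) u := by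
  intro s s' h
  simp only [qValue, ofReal_cost]
  have := N.expect_step_mono_age hV r u h
  dsimp only at this
  gcongr

theorem value_mono_age (N : Node R) (a : ℝ≥0∞) (r : Fin R) :
    Monotone fun s => N.value a (s, r) := by
  have h : ∀ n : ℕ, ∀ r, Monotone fun s => (N.bellman a)^[n] 0 (s, r) := by
    intro n
    induction n with
    | zero => intro r s s' _; simp
    | succ n ih =>
      intro r
      simp only [Function.iterate_succ_apply']
      exact (N.qValue_mono_age a ih r true).min (N.qValue_mono_age a ih r false)
  exact fun s s' hs => iSup_mono fun n => h n r hs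

/-- Under the same action, the current slot alone costs `ω(r) s` more from age `s + 1` than from age
`1`, and the continuation is no cheaper. -/
theorem value_one_add_le (N : Node R) (a : ℝ≥0∞) (s : ℕ) (r : Fin R) :
    N.value a (1, r) + ENNReal.ofReal (N.ω r) * s ≤ N.value a (s + 1, r) := by
  have h : ∀ u, N.qValue a (N.value a) (1, r) u + ENNReal.ofReal (N.ω r) * s ≤
      N.qValue a (N.value a) (s + 1, r) u := by
    intro u
    have hstep := N.expect_step_mono_age (N.value_mono_age a) r u (Nat.le_add_left 1 s)
    dsimp only at hstep
    simp only [qValue, ofReal_cost]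
    calc _ = (ENNReal.ofReal (N.ω r) * (s + 1 : ℕ) + if u then ENNReal.ofReal N.η else 0) +
          a * expect (N.step (1, r) u) (N.value a) := by
          push_cast; ring
      _ ≤ _ := by gcongr
  rw [← bellman_value]
  refine le_min ?_ ?_
  · exact (add_le_add_left (N.bellman_le_qValue a _ _ true) _).trans (h true)
  · exact (add_le_add_left (N.bellman_le_qValue a _ _ false) _).trans (h false)

/-- If the discount factor is at least one half, transmitting is optimal at all large ages, and the
bound on the age does not depend on the discount factor. -/
theorem transmit_le_idle (N : Node R) {a : ℝ≥0∞} (ha : 2⁻¹ ≤ a) {s : ℕ} (hs : 0 < s)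
    (hB : ∀ r, ENNReal.ofReal N.η ≤ 2⁻¹ * (ENNReal.ofReal (N.ω r) * s)) (r : Fin R) :
    ENNReal.ofReal N.η + a * expect (N.step (0, r) true) (N.value a) ≤
      a * expect (N.step (s, r) false) (N.value a) := by
  rw [← expect_const (N.step (0, r) true) (ENNReal.ofReal N.η), ← expect_const_mul,
    ← expect_const_mul, ← expect_add, expect_step, expect_step]
  -- Both actions are coupled through the same arrival and the same next weight. Idling leads to age
  -- `s + 1`, transmitting to age at most `1`, and the gap in value, at least `ω(r') s`, pays for
  -- `η` after discounting by `a ≥ 1/2`.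
  refine expect_mono _ fun b => expect_mono _ fun r' => ?_
  have h1 : nextAge s false b = s + 1 := by simp [nextAge, hs.ne']
  have h2 : nextAge 0 true b ≤ 1 := by cases b <;> simp [nextAge]
  simp only [h1]
  calc ENNReal.ofReal N.η + a * N.value a (nextAge 0 true b, r')
      ≤ a * (ENNReal.ofReal (N.ω r') * s) + a * N.value a (1, r') :=
        add_le_add ((hB r').trans (mul_le_mul_left ha _))
          (mul_le_mul_right (N.value_mono_age a r' h2) _)
    _ = a * (N.value a (1, r') + ENNReal.ofReal (N.ω r') * s) := by rw [mul_add, add_comm]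
    _ ≤ _ := mul_le_mul_right (N.value_one_add_le a s r') _

theorem expect_step_true (N : Node R) (s : ℕ) (r : Fin R) (V : State R → ℝ≥0∞) :
    expect (N.step (s, r) true) V = expect (N.step (0, r) true) V := by
  simp [expect_step, nextAge]

end Node

/-- The policy that transmits exactly when the age reaches the threshold of the weight state. -/
def thresholdPolicy (τ : Fin R → ℕ) : StationaryPolicy R :=
  fun x => PMF.pure (decide (τ x.2 ≤ x.1))

namespace Node

/-- The term `ω(r) s` is common to both actions. What remains is constant in `s` for transmitting
and increasing in `s` for idling, so the preference switches at most once. Taking values in `Fin (B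
+ 1)` leaves finitely many candidates `τ`. -/
theorem exists_threshold (N : Node R) {a : ℝ≥0∞} (ha : 2⁻¹ ≤ a) {B : ℕ} (hB0 : 0 < B)
    (hB : ∀ r, ENNReal.ofReal N.η ≤ 2⁻¹ * (ENNReal.ofReal (N.ω r) * B)) :
    ∃ τ : Fin R → Fin (B + 1), ∀ x,
      N.qValue a (N.value a) x (decide ((τ x.2 : ℕ) ≤ x.1)) ≤ N.value a x := by
  classical
  let p : Fin R → ℕ → Prop := fun r s =>
    ENNReal.ofReal N.η + a * expect (N.step (0, r) true) (N.value a) ≤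
      a * expect (N.step (s, r) false) (N.value a)
  have hp : ∀ r, p r B := N.transmit_le_idle ha hB0 hB
  have hpmono : ∀ r s s', s ≤ s' → p r s → p r s' := fun r s s' h hs =>
    hs.trans (mul_le_mul_right (N.expect_step_mono_age (N.value_mono_age a) r false h) _)
  have hq : ∀ s r, N.qValue a (N.value a) (s, r) true = ENNReal.ofReal (N.ω r) * s +
      (ENNReal.ofReal N.η + a * expect (N.step (0, r) true) (N.value a)) := by
    intro s r
    simp [qValue, ofReal_cost, expect_step_true N s, add_assoc]
  have hq' : ∀ s r, N.qValue a (N.value a) (s, r) false = ENNReal.ofReal (N.ω r) * s +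
      a * expect (N.step (s, r) false) (N.value a) := by
    intro s r
    simp [qValue, ofReal_cost]
  refine ⟨fun r => ⟨Nat.find ⟨B, hp r⟩, Nat.lt_succ_of_le (Nat.find_min' _ (hp r))⟩, ?_⟩
  rintro ⟨s, r⟩
  rw [← congrFun (N.bellman_value a) (s, r), bellman]
  by_cases h : Nat.find ⟨B, hp r⟩ ≤ s
  · have hps : p r s := hpmono r _ s h (Nat.find_spec ⟨B, hp r⟩)
    simp only [h, decide_true]
    refine le_min le_rfl ?_
    rw [hq, hq']
    exact add_le_add_right hps _
  · have hps : ¬ p r s := Nat.find_min ⟨B, hp r⟩ (not_le.1 h)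
    simp only [h, decide_false]
    refine le_min ?_ le_rfl
    rw [hq, hq']
    exact add_le_add_right (not_le.1 hps).le _

/-- One threshold policy is optimal for discount factors arbitrarily close to one. -/
theorem exists_frequently_discount_optimal (N : Node R) :
    ∃ τ : Fin R → ℕ, ∃ᶠ n in atTop, ∀ (x : State R) (π : Policy R),
      ∑' t, discount n ^ t * N.stageCost (thresholdPolicy τ).toPolicy x t ≤
        ∑' t, discount n ^ t * N.stageCost π x t := by
  obtain ⟨B, hB0, hB⟩ : ∃ B : ℕ, 0 < B ∧
      ∀ r, ENNReal.ofReal N.η ≤ 2⁻¹ * (ENNReal.ofReal (N.ω r) * B) := by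
    have hr : ∀ r, ∀ᶠ B : ℕ in atTop,
        ENNReal.ofReal N.η ≤ 2⁻¹ * (ENNReal.ofReal (N.ω r) * B) := by
      intro r
      obtain ⟨m, hm⟩ := exists_nat_gt (2 * N.η / N.ω r)
      filter_upwards [eventually_ge_atTop m] with B hmB
      have hω := N.ω_pos r
      rw [div_lt_iff₀ hω] at hm
      have hmB' : (m : ℝ) ≤ B := by exact_mod_cast hmB
      have h2 : (2⁻¹ : ℝ≥0∞) = ENNReal.ofReal 2⁻¹ := by
        rw [ENNReal.ofReal_inv_of_pos two_pos]; simp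
      rw [h2, ← ENNReal.ofReal_natCast, ← ENNReal.ofReal_mul hω.le,
        ← ENNReal.ofReal_mul (by norm_num)]
      refine ENNReal.ofReal_le_ofReal ?_
      nlinarith
    obtain ⟨B, h, h'⟩ := ((eventually_gt_atTop 0).and (eventually_all.2 hr)).exists
    exact ⟨B, h, h'⟩
  choose τ hτ using fun n => N.exists_threshold (half_le_discount n) hB0 hB
  -- Pigeonhole: one of finitely many threshold vectors recurs for infinitely many `n`.
  obtain ⟨σ, hσ⟩ : ∃ σ : Fin R → Fin (B + 1), ∃ᶠ n in atTop, τ n = σ := by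
    by_contra h
    simp only [not_exists, not_frequently] at h
    obtain ⟨n, hn⟩ := (eventually_all.2 h).exists
    exact hn (τ n) rfl
  refine ⟨fun r => σ r, hσ.mono ?_⟩
  rintro n rfl x π
  refine le_trans ?_ (N.value_le_tsum _ π x)
  refine N.tsum_le_of_expect_qValue_le _ _ _ (fun y => ?_) x
  rw [thresholdPolicy, expect_pure]
  exact hτ n y

/-! ### Convergence of the averages under a threshold policy -/

theorem stageCost_thresholdPolicy (N : Node R) (τ : Fin R → ℕ) (x : State R) (t : ℕ) :
    N.stageCost (thresholdPolicy τ).toPolicy x t =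
      (fun g y => expect (N.step y (decide (τ y.2 ≤ y.1))) g)^[t]
        (fun y => ENNReal.ofReal (N.cost y (decide (τ y.2 ≤ y.1)))) x := by
  -- The function `g` is general because peeling off the last slot of the law replaces `g` by its
  -- one-step expectation.
  have h : ∀ (t : ℕ) (g : State R → ℝ≥0∞),
      expect (N.law (thresholdPolicy τ).toPolicy x t) (fun p => g p.2) =
        (fun g y => expect (N.step y (decide (τ y.2 ≤ y.1))) g)^[t] g x := by
    intro t
    induction t with
    | zero => intro g; simp [law, expect_pure]
    | succ t ih =>
      intro g
      rw [Function.iterate_succ_apply, ← ih, expect_law_succ]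
      simp only [StationaryPolicy.toPolicy, thresholdPolicy, expect_pure]
  rw [← h, stageCost]
  simp only [StationaryPolicy.toPolicy, thresholdPolicy, expect_pure]

/-- Idling happens only below the threshold, so an age bound `M` that covers the initial age, all
thresholds and `1` is preserved. The chain thus lives on finitely many states. -/
theorem exists_tendsto_average_stageCost (N : Node R) (τ : Fin R → ℕ) (x : State R) :
    ∃ J : ℝ≥0, Tendsto (fun T : ℕ => (T : ℝ≥0∞)⁻¹ *
      ∑ t ∈ Finset.range T, N.stageCost (thresholdPolicy τ).toPolicy x t)
      atTop (𝓝 (J : ℝ≥0∞)) := by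
  obtain ⟨M, hxM, hM1, hτM⟩ : ∃ M : ℕ, x.1 ≤ M ∧ 1 ≤ M ∧ ∀ r, τ r ≤ M :=
    ⟨x.1 + 1 + ∑ r, τ r, by omega, by omega, fun r =>
      (Finset.single_le_sum (fun i _ => Nat.zero_le (τ i)) (Finset.mem_univ r)).trans
        (Nat.le_add_left _ _)⟩
  -- ages up to `M` are never left
  let incl : Fin (M + 1) × Fin R → State R := fun z => (z.1, z.2)
  -- Truncation only makes the map total; on the ages that occur it inverts `incl`.
  let clamp : State R → Fin (M + 1) × Fin R := fun y => (⟨min y.1 M, by omega⟩, y.2)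
  have hclamp : ∀ y : State R, y.1 ≤ M → incl (clamp y) = y := fun y hy => by
    simp [incl, clamp, hy]
  let act : State R → Action := fun y => decide (τ y.2 ≤ y.1)
  have hnext : ∀ y : State R, y.1 ≤ M → ∀ b, nextAge y.1 (act y) b ≤ M := by
    intro y hy b
    simp only [nextAge, act, decide_eq_true_eq]
    split_ifs with h1 h2
    · exact hM1
    · exact Nat.zero_le _
    · have := hτM y.2
      omega
  let k : Fin (M + 1) × Fin R → PMF (Fin (M + 1) × Fin R) := fun z =>
    (N.step (incl z) (act (incl z))).map clamp
  obtain ⟨J, hJ⟩ := exists_tendsto_average_expect_iterate k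
    (fun z => (N.cost (incl z) (act (incl z))).toNNReal) (clamp x)
  refine ⟨J, hJ.congr fun T => ?_⟩
  have hiter : ∀ (t : ℕ) z, (fun g z => expect (k z) g)^[t]
      (fun z => ((N.cost (incl z) (act (incl z))).toNNReal : ℝ≥0∞)) z =
      (fun g y => expect (N.step y (act y)) g)^[t]
        (fun y => ENNReal.ofReal (N.cost y (act y))) (incl z) := by
    intro t
    induction t with
    | zero => intro z; rfl
    | succ t ih =>
      intro z
      rw [Function.iterate_succ_apply', Function.iterate_succ_apply', funext ih]
      simp only [k]
      rw [expect_map, expect_step, expect_step]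
      congr 1
      ext b
      congr 1
      ext r'
      rw [hclamp]
      exact hnext (incl z) (Nat.lt_succ_iff.1 z.1.2) b
  simp only [stageCost_thresholdPolicy, hiter, hclamp x hxM]
  rfl

end Node

end AoS

end

theorem theorem1 {R : ℕ} (N : AoS.Node R) :
    ∃ (f : AoS.StationaryPolicy R) (τ : Fin R → ℕ),
      N.IsOptimal f.toPolicy ∧
      (∀ (s : ℕ) (r : Fin R), τ r ≤ s → f (s, r) true = 1) ∧
      (∀ (s : ℕ) (r : Fin R), s < τ r → f (s, r) false = 1) := by
  obtain ⟨τ, hτ⟩ := N.exists_frequently_discount_optimal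
  refine ⟨AoS.thresholdPolicy τ, τ, fun x => ?_, fun s r h => ?_, fun s r h => ?_⟩
  -- The slot-cost formula is available for `T > 0`, which suffices for limits at infinity.
  · have havg : ∀ π : AoS.Policy R, (fun T : ℕ => N.expectedAverage π x T) =ᶠ[atTop]
        fun T : ℕ => (T : ℝ≥0∞)⁻¹ * ∑ t ∈ Finset.range T, N.stageCost π x t := fun π => by
      filter_upwards [eventually_gt_atTop 0] with T hT using N.expectedAverage_eq π x hT
    obtain ⟨J, hJ⟩ := N.exists_tendsto_average_stageCost τ x
    have hJ' := hJ.congr' (havg _).symm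
    refine ⟨⟨J, hJ'⟩, fun π => ?_⟩
    rw [AoS.Node.averageCost, hJ'.limsup_eq, AoS.Node.averageCost, limsup_congr (havg π)]
    exact AoS.le_limsup_average_of_frequently_discounted_le hJ (hτ.mono fun n hn => hn x π)
  · simp [AoS.thresholdPolicy, h]
  · simp [AoS.thresholdPolicy, not_le.2 h]
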